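/- Let $k$ be an infinite field, $R=k[x_1,\dots,x_r]$ the standard graded polynomial ring, and $A=R/I$ an artinian Gorenstein graded $k$-algebra; that is, $I\subset R$ is a homogeneous ideal, $A$ is artinian, and its socle $\{a\in A : x_1a=\dots=x_ra=0\}$ is one-dimensional over $k$. Let $h=(1,h_1,h_2,\dots,h_e)$, $h_d=\dim_k A_d$, be its $h$-vector, where $e$ is the socle degree of $A$ (the largest degree with $A_e\ne 0$), and suppose that $h_1=r$ (so that $h=(1,r,h_2,\dots,h_{e-2},r,1)$ when $e\geq 2$). For positive integers $n$ and $d$, the $d$-binomial expansion of $n$ is the unique expression $$n_{(d)}=\binom{n_d}{d}+\binom{n_{d-1}}{d-1}+\dots+\binom{n_j}{j},\qquad n_d>n_{d-1}>\dots>n_j\ge j\ge 1,$$ and for integers $a,b$ one puts $$\bigl(n_{(d)}\bigr)_a^b=\binom{n_d+b}{d+a}+\binom{n_{d-1}+b}{d-1+a}+\dots+\binom{n_j+b}{j+a},$$ where $\binom{m}{q}=0$ whenever $m<q$ or $q<0$. Then, for every integer $i$ with $1\le i\le \frac e2-1$, $$h_{i+1}\ \ge\ \bigl((h_i)_{(e-i)}\bigr)_{-1}^{-1}+\bigl((h_i)_{(e-i)}\bigr)_{-(e-2i-1)}^{-(e-2i)}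 .$$ -/

import Mathlib

noncomputable section

namespace GorensteinBound

open MvPolynomial

attribute [local instance] MvPolynomial.gradedAlgebra

/-- The degree `d` component `A_d` of the quotient `A = k[x_1, …, x_r] / I`: the classes of the
homogeneous polynomials of degree `d`. -/
def gradedPiece {k : Type*} [Field k] {r : ℕ} (I : Ideal (MvPolynomial (Fin r) k)) (d : ℕ) :
    Submodule k (MvPolynomial (Fin r) k ⧸ I) :=
  (homogeneousSubmodule (Fin r) k d).map (Ideal.Quotient.mkₐ k I).toLinearMap

/-- The Hilbert function `d ↦ dim_k A_d` of `A = k[x_1, …, x_r] / I`. -/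
def hilbertFunction {k : Type*} [Field k] {r : ℕ} (I : Ideal (MvPolynomial (Fin r) k)) (d : ℕ) :
    ℕ :=
  Module.finrank k (gradedPiece I d)

/-- The socle of `A = k[x_1, …, x_r] / I`: the elements of `A` annihilated by the maximal ideal
generated by the variables. -/
def socle {k : Type*} [Field k] {r : ℕ} (I : Ideal (MvPolynomial (Fin r) k)) :
    Submodule k (MvPolynomial (Fin r) k ⧸ I) where
  carrier := {a | ∀ j : Fin r, Ideal.Quotient.mk I (X j) * a = 0}
  zero_mem' := fun _ => mul_zero _
  add_mem' := fun {a b} ha hb j => by rw [mul_add, ha j, hb j, add_zero]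
  smul_mem' := fun c a ha j => by rw [mul_smul_comm, ha j, smul_zero]

/-- `A = k[x_1, …, x_r] / I` is an artinian Gorenstein standard graded `k`-algebra: `I` is
homogeneous, `A` is artinian, and the socle of `A` is one-dimensional over `k`. -/
structure IsArtinianGorenstein {k : Type*} [Field k] {r : ℕ}
    (I : Ideal (MvPolynomial (Fin r) k)) : Prop where
  homogeneous : I.IsHomogeneous (homogeneousSubmodule (Fin r) k)
  artinian : IsArtinianRing (MvPolynomial (Fin r) k ⧸ I)
  finrank_socle : Module.finrank k (socle I) = 1

/-- `(h 0, h 1, …, h e)` is the `h`-vector of `A = k[x_1, …, x_r] / I`: `h` is the Hilbert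
function of `A` and `e` is the last degree in which `A` does not vanish (the socle degree of `A`
when `A` is artinian Gorenstein). -/
structure IsHVector {k : Type*} [Field k] {r : ℕ} (I : Ideal (MvPolynomial (Fin r) k))
    (e : ℕ) (h : ℕ → ℕ) : Prop where
  eq_hilbertFunction : ∀ d, h d = hilbertFunction I d
  last_ne_zero : h e ≠ 0
  eq_zero_of_gt : ∀ d, e < d → h d = 0

/-- The binomial coefficient of two integers, with the convention that it is `0` whenever
`m < q` or `q < 0`. -/
def binom (m q : ℤ) : ℕ :=
  if m < q ∨ q < 0 then 0 else m.toNat.choose q.toNat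

/-- `n = C(N i, i) + C(N (i-1), i-1) + ⋯ + C(N j, j)` with `N i > N (i-1) > ⋯ > N j ≥ j ≥ 1`,
that is, the `i`-binomial expansion of `n`. Only the values `N j, …, N i` matter. -/
structure IsBinomialExpansion (n i j : ℕ) (N : ℕ → ℕ) : Prop where
  one_le : 1 ≤ j
  le_top : j ≤ i
  le_last : j ≤ N j
  lt_succ : ∀ t, j ≤ t → t < i → N t < N (t + 1)
  sum_eq : n = ∑ t ∈ Finset.Icc j i, (N t).choose t

/-- `(n_(i))_a^b = C(N i + b, i + a) + ⋯ + C(N j + b, j + a)`, where `N j, …, N i` are the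
entries of the `i`-binomial expansion of `n`. -/
def shiftedSum (i j : ℕ) (N : ℕ → ℕ) (a b : ℤ) : ℕ :=
  ∑ t ∈ Finset.Icc j i, binom ((N t : ℤ) + b) ((t : ℤ) + a)

/-- Every positive integer has an `i`-binomial expansion for every positive `i`. -/
theorem exists_isBinomialExpansion (i n : ℕ) (hi : 1 ≤ i) (hn : 1 ≤ n) :
    ∃ (j : ℕ) (N : ℕ → ℕ), IsBinomialExpansion n i j N := by
  induction i, hi using Nat.le_induction generalizing n with
  | base => exact ⟨1, fun _ => n, le_rfl, le_rfl, hn, by intros; omega, by simp⟩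
  | succ i hi ih =>
    obtain ⟨m, hm1, hm2, hm3⟩ : ∃ m, i + 1 ≤ m ∧ m.choose (i + 1) ≤ n ∧
        n < (m + 1).choose (i + 1) := by
      have hex : ∃ m, n < (m + 1).choose (i + 1) := by
        refine ⟨n + i, ?_⟩
        have h1 : n + 1 ≤ (n + 1 + i).choose (i + 1) := by
          clear ih hn
          induction n with
          | zero => exact Nat.choose_pos (by omega)
          | succ n ih' =>
            have h2 : (n + 1 + 1 + i).choose (i + 1)
                = (n + 1 + i).choose i + (n + 1 + i).choose (i + 1) := by
              rw [show n + 1 + 1 + i = (n + 1 + i) + 1 by omega, Nat.choose_succ_succ]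
            have h3 : 0 < (n + 1 + i).choose i := Nat.choose_pos (by omega)
            omega
        rw [show n + i + 1 = n + 1 + i by omega]
        omega
      classical
      have hspec := Nat.find_spec hex
      have hge : i + 1 ≤ Nat.find hex := by
        by_contra hlt
        have h4 : (Nat.find hex + 1).choose (i + 1) ≤ (i + 1).choose (i + 1) :=
          Nat.choose_le_choose _ (by omega)
        rw [Nat.choose_self] at h4
        omega
      refine ⟨Nat.find hex, hge, ?_, hspec⟩
      have h5 := Nat.find_min hex (m := Nat.find hex - 1) (by omega)
      rw [show Nat.find hex - 1 + 1 = Nat.find hex by omega] at h5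
      omega
    rcases hm2.eq_or_lt with heq | hlt
    · exact ⟨i + 1, fun _ => m, by omega, le_rfl, hm1, by intros; omega, by simp [heq]⟩
    · obtain ⟨j, N, hN⟩ := ih (n - m.choose (i + 1)) (by omega)
      have hle : (N i).choose i ≤ n - m.choose (i + 1) := by
        rw [hN.sum_eq]
        exact Finset.single_le_sum (f := fun t => (N t).choose t) (fun _ _ => Nat.zero_le _)
          (Finset.mem_Icc.2 ⟨hN.le_top, le_rfl⟩)
      have hNi : N i < m := by
        by_contra hcon
        have h6 : m.choose i ≤ (N i).choose i := Nat.choose_le_choose _ (by omega)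
        rw [Nat.choose_succ_succ'] at hm3
        omega
      have hji := hN.le_top
      refine ⟨j, fun t => if t = i + 1 then m else N t, hN.one_le, by omega, ?_, ?_, ?_⟩
      · have := hN.le_last
        simp only [show j ≠ i + 1 by omega, if_false]
        exact this
      · intro t ht1 ht2
        by_cases hti : t = i
        · subst hti
          simpa using hNi
        · simp only [show t ≠ i + 1 by omega, show t + 1 ≠ i + 1 by omega, if_false]
          exact hN.lt_succ t ht1 (by omega)
      · have hs := hN.sum_eq
        rw [Finset.sum_Icc_succ_top (by omega)]
        have hc : ∑ t ∈ Finset.Icc j i, (if t = i + 1 then m else N t).choose t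
            = ∑ t ∈ Finset.Icc j i, (N t).choose t := by
          refine Finset.sum_congr rfl fun t ht => ?_
          rw [Finset.mem_Icc] at ht
          rw [if_neg (by omega)]
        rw [hc, if_pos rfl]
        omega

end GorensteinBound

end

/-! Write `A = R/I`, let `z` be a general linear form and let `c` be the Hilbert function of `A/zA`.
The socle pairing makes `z : A_i → A_{i+1}` and `z : A_{e-i-1} → A_{e-i}` dual to each other, so
their ranks agree: `h_{i+1} - c_{i+1} = h_{e-i} - c_{e-i}`, and `h_{e-i} = h_i` by symmetry
(`finrank_map_mulLeft_gradedPiece`, `hilbertFunction_symm`).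

Green's hyperplane restriction theorem bounds `c_{e-i}` above by `g = greenFun (e-i) (h_i)`
(`exists_quotHilb_addForm_le_greenFun`). Macaulay's theorem, applied `s = e - 2i - 1` times to
`A/zA`, bounds `c_{i+1}` below by `M(c_{e-i})`, where `M` is `macaulayIter (i+1) s`. Hence `h_{i+1}
≥ h_i - c_{e-i} + M(c_{e-i})`. As `n - M(n)` is nondecreasing in `n`, the number `c_{e-i}` may be
replaced by `g`, which gives `hVector_bound`: `h_{i+1} ≥ (h_i - g) + M(g)`.

Here `h_i - g` is the first shifted sum, and `M(g)` is at least the second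
(`IsBinomialExpansion.shiftedSum_le`). Green's theorem is proved over any infinite field by cutting
with a second general form; Macaulay's bound is deduced from it. -/

namespace GorensteinBound

/-! ### Arithmetic of Green's and Macaulay's functions. -/

/-- The largest `p` with `p.choose d ≤ n`, for `1 ≤ d`. -/
def topEntry (d n : ℕ) : ℕ :=
  Nat.findGreatest (fun p => p.choose d ≤ n) (n + d)

/-- Green's function `n ↦ C(N_d - 1, d) + C(N_{d-1} - 1, d - 1) + ⋯`, where
`n = C(N_d, d) + C(N_{d-1}, d-1) + ⋯` is the `d`-binomial expansion of `n`. -/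
def greenFun : ℕ → ℕ → ℕ
  -- Adding a linear form to an ideal changes nothing in degree `0`, so Green's bound there is the
  -- identity.
  | 0, n => n
  | d + 1, n =>
    (topEntry (d + 1) n - 1).choose (d + 1) +
      greenFun d (n - (topEntry (d + 1) n).choose (d + 1))

/-- Macaulay's lower bound in degree `d - 1` for a Hilbert function with value `n` in degree `d`. -/
def macaulayFun (d n : ℕ) : ℕ := n - greenFun d n

theorem choose_topEntry_le (d n : ℕ) : (topEntry (d + 1) n).choose (d + 1) ≤ n := by
  have := Nat.findGreatest_spec (P := fun p => p.choose (d + 1) ≤ n) (n := n + (d + 1)) (m := 0)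
    (Nat.zero_le _) (by simp)
  exact this

/-- Shows that the search range in `topEntry` is large enough. -/
theorem lt_choose_add (d n : ℕ) : n < (n + d + 1).choose (d + 1) := by
  induction n with
  | zero => exact Nat.choose_pos (by omega)
  | succ n ih =>
    have h2 : (n + 1 + d + 1).choose (d + 1)
        = (n + d + 1).choose d + (n + d + 1).choose (d + 1) := by
      rw [show n + 1 + d + 1 = (n + d + 1) + 1 by omega, Nat.choose_succ_succ']
    have h3 : 0 < (n + d + 1).choose d := Nat.choose_pos (by omega)
    omega

theorem topEntry_eq {d n p : ℕ} (h1 : p.choose (d + 1) ≤ n) (h2 : n < (p + 1).choose (d + 1)) :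
    topEntry (d + 1) n = p := by
  have hp : p < n + d + 1 := by
    by_contra hcon
    have := (lt_choose_add d n).trans_le (Nat.choose_le_choose (d + 1) (not_lt.1 hcon))
    omega
  apply le_antisymm
  · by_contra hcon
    have := Nat.choose_le_choose (d + 1) (show p + 1 ≤ topEntry (d + 1) n by omega)
    have := choose_topEntry_le d n
    omega
  · exact Nat.le_findGreatest (by omega) h1

theorem lt_choose_topEntry (d n : ℕ) : n < (topEntry (d + 1) n + 1).choose (d + 1) := by
  by_contra hcon
  have hlt : topEntry (d + 1) n + 1 ≤ n + (d + 1) := by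
    by_contra h
    have := (lt_choose_add d n).trans_le
      (Nat.choose_le_choose (d + 1) (show n + d + 1 ≤ topEntry (d + 1) n + 1 by omega))
    omega
  have := Nat.le_findGreatest (P := fun p => p.choose (d + 1) ≤ n) hlt (not_lt.1 hcon)
  change _ ≤ topEntry (d + 1) n at this
  omega

theorem exists_top (d n : ℕ) : ∃ p ρ, d ≤ p ∧ ρ < p.choose d ∧ n = p.choose (d + 1) + ρ := by
  have h1 := choose_topEntry_le d n
  have h2 := lt_choose_topEntry d n
  rw [Nat.choose_succ_succ'] at h2
  refine ⟨topEntry (d + 1) n, n - (topEntry (d + 1) n).choose (d + 1), ?_, by omega, by omega⟩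
  by_contra hcon
  rw [Nat.choose_eq_zero_of_lt (by omega), Nat.choose_eq_zero_of_lt (by omega)] at h2
  omega

theorem greenFun_succ {d p ρ : ℕ} (h : ρ < p.choose d) :
    greenFun (d + 1) (p.choose (d + 1) + ρ) = (p - 1).choose (d + 1) + greenFun d ρ := by
  rw [greenFun, topEntry_eq (d := d) (p := p) (by omega) (by rw [Nat.choose_succ_succ']; omega)]
  simp

theorem greenFun_one (n : ℕ) : greenFun 1 n = n - 1 := by
  have := greenFun_succ (d := 0) (p := n) (ρ := 0) (by simp)
  simpa [greenFun] using this

theorem greenFun_zero_right (d : ℕ) : greenFun d 0 = 0 := by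
  induction d with
  | zero => rfl
  | succ d ih =>
    have := greenFun_succ (d := d) (p := d) (ρ := 0) (by simp)
    rw [Nat.choose_succ_self, zero_add, ih, Nat.choose_eq_zero_of_lt (by omega)] at this
    exact this

theorem greenFun_choose (d p : ℕ) (hp : d ≤ p) :
    greenFun (d + 1) (p.choose (d + 1)) = (p - 1).choose (d + 1) := by
  have := greenFun_succ (d := d) (p := p) (ρ := 0) (Nat.choose_pos hp)
  rwa [greenFun_zero_right] at this

theorem choose_pred_add {p : ℕ} (d : ℕ) (hp : 1 ≤ p) :
    p.choose (d + 1) = (p - 1).choose (d + 1) + (p - 1).choose d := by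
  obtain ⟨q, rfl⟩ := Nat.exists_eq_add_of_le' hp
  rw [Nat.choose_succ_succ', add_comm]
  rfl

/-- The values of Green's function increase by `0` or `1`. -/
theorem greenFun_step (d n : ℕ) :
    greenFun d n ≤ greenFun d (n + 1) ∧ greenFun d (n + 1) ≤ greenFun d n + 1 := by
  induction d generalizing n with
  | zero => simp [greenFun]
  | succ d ih =>
    rcases Nat.eq_zero_or_pos d with rfl | hd
    · simp only [zero_add, greenFun_one]; omega
    obtain ⟨p, ρ, hp, hρ, rfl⟩ := exists_top d n
    obtain ⟨d, rfl⟩ : ∃ d', d = d' + 1 := ⟨d - 1, by omega⟩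
    rw [greenFun_succ hρ]
    rcases Nat.lt_or_ge (ρ + 1) (p.choose (d + 1)) with h | h
    · rw [add_assoc (p.choose _), greenFun_succ h]
      have := ih ρ
      omega
    -- The remainder overflows, and the top entry jumps from `p` to `p + 1`.
    · have hn : p.choose (d + 1 + 1) + ρ + 1 = (p + 1).choose (d + 1 + 1) := by
        rw [Nat.choose_succ_succ']; omega
      have h1 := ih ρ
      rw [show ρ + 1 = p.choose (d + 1) by omega, greenFun_choose d p (by omega)] at h1
      rw [hn, greenFun_choose _ _ (by omega)]
      have := choose_pred_add (p := p) (d + 1) (by omega)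
      simp only [Nat.add_sub_cancel]
      omega

theorem greenFun_mono (d : ℕ) : Monotone (greenFun d) :=
  monotone_nat_of_le_succ fun n => (greenFun_step d n).1

theorem greenFun_le (d n : ℕ) : greenFun d n ≤ n := by
  induction n with
  | zero => rw [greenFun_zero_right]
  | succ n ih =>
    have := (greenFun_step d n).2
    omega

theorem macaulayFun_add_greenFun (d n : ℕ) : macaulayFun d n + greenFun d n = n := by
  have := greenFun_le d n
  unfold macaulayFun
  omega

theorem macaulayFun_mono (d : ℕ) : Monotone (macaulayFun d) := by
  refine monotone_nat_of_le_succ fun n => ?_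
  have := macaulayFun_add_greenFun d n
  have := macaulayFun_add_greenFun d (n + 1)
  have := greenFun_step d n
  omega

theorem macaulayFun_zero_right (d : ℕ) : macaulayFun d 0 = 0 := by
  simp [macaulayFun]

theorem macaulayFun_succ {d p ρ : ℕ} (hp : 1 ≤ p) (h : ρ < p.choose d) :
    macaulayFun (d + 1) (p.choose (d + 1) + ρ) = (p - 1).choose d + macaulayFun d ρ := by
  have h1 := greenFun_succ h
  have := macaulayFun_add_greenFun (d + 1) (p.choose (d + 1) + ρ)
  have := macaulayFun_add_greenFun d ρ
  have := choose_pred_add d hp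
  omega

/-- At the boundary `ρ = p.choose (d + 1)` the top entry is really `p + 1`, but Pascal's rule gives
the same value. The case is needed because `greenFun ρ + 1` can reach the boundary. -/
theorem macaulayFun_succ' {d p ρ : ℕ} (hp : d + 1 ≤ p) (h : ρ ≤ p.choose (d + 1)) :
    macaulayFun (d + 1 + 1) (p.choose (d + 1 + 1) + ρ)
      = (p - 1).choose (d + 1) + macaulayFun (d + 1) ρ := by
  rcases h.lt_or_eq with h | rfl
  · exact macaulayFun_succ (by omega) h
  · have h1 := macaulayFun_succ (d := d + 1) (p := p + 1) (ρ := 0) (by omega)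
      (Nat.choose_pos (by omega))
    have h2 := macaulayFun_succ (d := d) (p := p) (ρ := 0) (by omega)
      (Nat.choose_pos (by omega))
    rw [macaulayFun_zero_right, add_zero] at h1 h2
    rw [h2, add_comm (p.choose (d + 1 + 1)), ← Nat.choose_succ_succ', h1]
    have := choose_pred_add (p := p) d (by omega)
    simp only [Nat.add_sub_cancel, add_zero]
    omega

theorem macaulayFun_one {n : ℕ} (hn : 1 ≤ n) : macaulayFun 1 n = 1 := by
  simp only [macaulayFun, greenFun_one]; omega

theorem macaulayFun_pos (d : ℕ) {n : ℕ} (hn : 1 ≤ n) : 1 ≤ macaulayFun (d + 1) n := by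
  have h := macaulayFun_mono (d + 1) hn
  have h1 : greenFun (d + 1) 1 = 0 := by
    have := greenFun_choose d (d + 1) (by omega)
    rw [Nat.choose_self, Nat.add_sub_cancel, Nat.choose_succ_self] at this
    exact this
  have : macaulayFun (d + 1) 1 = 1 := by simp [macaulayFun, h1]
  omega

theorem greenFun_lt {d p ρ : ℕ} (hp : d + 2 ≤ p) (hρ : ρ < p.choose (d + 1)) :
    greenFun (d + 1) ρ < (p - 1).choose (d + 1) := by
  induction d generalizing p ρ with
  | zero => rw [zero_add, greenFun_one, Nat.choose_one_right] at *; omega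
  | succ d ih =>
    obtain ⟨q, σ, hq, hσ, rfl⟩ := exists_top (d + 1) ρ
    rw [greenFun_succ hσ]
    have hqp : q < p := by
      by_contra hcon
      have := Nat.choose_le_choose (d + 1 + 1) (not_lt.1 hcon)
      omega
    rcases Nat.eq_or_lt_of_le hq with rfl | hq
    · have h0 : σ = 0 := by rw [Nat.choose_self] at hσ; omega
      rw [h0, greenFun_zero_right, Nat.choose_eq_zero_of_lt (by omega)]
      exact Nat.choose_pos (by omega)
    · have h1 := ih (by omega) hσ
      have h2 := choose_pred_add (p := q) (d + 1) (by omega)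
      have h3 := Nat.choose_le_choose (d + 1 + 1) (show q ≤ p - 1 by omega)
      omega

/-- Peeling off the top binomial of `h` contributes the same binomial to both sides, which leaves
the claim for the remainder `ρ`. If `ρ = 0`, the `- 1` on the left is handled by monotonicity. -/
theorem greenFun_macaulayFun_lt (d h : ℕ) (hh : 1 ≤ h) :
    greenFun d (macaulayFun (d + 1) h - 1) + 1 ≤
      macaulayFun (d + 1) (greenFun (d + 1) h + 1) := by
  induction d generalizing h with
  | zero => simp [macaulayFun_one, hh, greenFun]
  | succ d ih =>
    obtain ⟨p, ρ, hp, hρ, rfl⟩ := exists_top (d + 1) h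
    have hp : d + 2 ≤ p := by
      by_contra hcon
      obtain rfl : p = d + 1 := by omega
      rw [Nat.choose_self] at hρ
      rw [Nat.choose_succ_self] at hh
      omega
    have h1 : greenFun (d + 1) ρ + 1 ≤ (p - 1).choose (d + 1) := greenFun_lt hp hρ
    rw [greenFun_succ hρ, macaulayFun_succ (by omega) hρ, add_assoc ((p - 1).choose _) (greenFun _ _),
      macaulayFun_succ' (by omega) h1]
    rcases Nat.eq_zero_or_pos ρ with rfl | hpos
    · rw [macaulayFun_zero_right, greenFun_zero_right, add_zero]
      have h2 := greenFun_mono (d + 1) (Nat.sub_le ((p - 1).choose (d + 1)) 1)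
      rw [greenFun_choose _ _ (by omega)] at h2
      have := macaulayFun_pos d (n := 0 + 1) le_rfl
      omega
    · have h2 := ih ρ hpos
      have h3 := macaulayFun_pos d hpos
      have h4 : macaulayFun (d + 1) ρ ≤ (p - 1).choose d := by
        have h5 := macaulayFun_mono (d + 1) hρ.le
        have h6 := macaulayFun_succ (d := d) (p := p) (ρ := 0) (by omega)
          (Nat.choose_pos (by omega))
        rw [macaulayFun_zero_right, add_zero, add_zero] at h6
        omega
      rw [Nat.add_sub_assoc h3, greenFun_succ (by omega)]
      omega

/-- The numerical step in the proof of Green's hyperplane restriction theorem. -/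
theorem le_greenFun_of_le (d a c : ℕ) (h : c ≤ greenFun d a + greenFun (d + 1) c) :
    c ≤ greenFun (d + 1) (a + c) := by
  -- With `g = greenFun (d + 1) (a + c) < c`, the hypothesis reads `macaulayFun (d + 1) c ≤ greenFun
  -- d a`, while `a` is less than `macaulayFun (d + 1) (a + c)`; monotonicity then contradicts
  -- `greenFun_macaulayFun_lt`.
  by_contra! hcon
  have h1 := greenFun_macaulayFun_lt d (a + c) (by omega)
  have h2 := macaulayFun_mono (d + 1) (show greenFun (d + 1) (a + c) + 1 ≤ c by omega)
  have h3 := macaulayFun_add_greenFun (d + 1) (a + c)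
  have h4 := macaulayFun_add_greenFun (d + 1) c
  have h5 := greenFun_mono d (show a ≤ macaulayFun (d + 1) (a + c) - 1 by omega)
  omega

/-- The lower bound in degree `d` for a Hilbert function with value `n` in degree `d + s`. -/
def macaulayIter (d : ℕ) : ℕ → ℕ → ℕ
  | 0, n => n
  | s + 1, n => macaulayIter d s (macaulayFun (d + s + 1) n)

theorem macaulayIter_mono (d s : ℕ) : Monotone (macaulayIter d s) := by
  induction s with
  | zero => exact monotone_id
  | succ s ih => exact ih.comp (macaulayFun_mono _)

/-- One Macaulay step lowers `n` by `greenFun n`, which is monotone in `n`; the losses add up over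
the steps. -/
theorem macaulayIter_sub_mono (d s : ℕ) {m n : ℕ} (h : m ≤ n) :
    m + macaulayIter d s n ≤ n + macaulayIter d s m := by
  induction s generalizing m n with
  | zero => simp [macaulayIter, add_comm]
  | succ s ih =>
    have h1 := ih (macaulayFun_mono (d + s + 1) h)
    have h2 := macaulayFun_add_greenFun (d + s + 1) m
    have h3 := macaulayFun_add_greenFun (d + s + 1) n
    have h4 := greenFun_mono (d + s + 1) h
    simp only [macaulayIter]
    omega

theorem macaulayIter_le {d : ℕ} (s : ℕ) {H : ℕ → ℕ}
    (hH : ∀ n, macaulayFun (n + 1) (H (n + 1)) ≤ H n) : macaulayIter d s (H (d + s)) ≤ H d := by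
  induction s with
  | zero => exact le_rfl
  | succ s ih => exact (macaulayIter_mono d s (hH (d + s))).trans ih

end GorensteinBound

namespace GorensteinBound

/-! ### Dimensions modulo a subspace. -/

section Codim

variable {k E F : Type*} [Field k] [AddCommGroup E] [Module k E] [AddCommGroup F] [Module k F]

theorem finrank_map_add_finrank_inf_ker (f : E →ₗ[k] F) (P : Submodule k E)
    [FiniteDimensional k P] :
    Module.finrank k (P.map f) + Module.finrank k (P ⊓ LinearMap.ker f : Submodule k E)
      = Module.finrank k P := by
  have h := LinearMap.finrank_range_add_finrank_ker (f.domRestrict P)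
  rw [LinearMap.range_domRestrict] at h
  rw [← h, LinearMap.ker_domRestrict, ← Submodule.map_comap_subtype,
    LinearEquiv.finrank_eq (Submodule.equivMapOfInjective _ P.injective_subtype _)]

/-- The dimension of the image of `P` modulo `T`. -/
noncomputable def dimMod (T P : Submodule k E) : ℕ :=
  Module.finrank k (P.map T.mkQ)

theorem dimMod_add_finrank_inf (T P : Submodule k E) [FiniteDimensional k P] :
    dimMod T P + Module.finrank k (P ⊓ T : Submodule k E) = Module.finrank k P := by
  have := finrank_map_add_finrank_inf_ker T.mkQ P
  rwa [Submodule.ker_mkQ] at this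

theorem dimMod_bot (P : Submodule k E) [FiniteDimensional k P] :
    dimMod ⊥ P = Module.finrank k P := by
  have := dimMod_add_finrank_inf ⊥ P
  rwa [inf_bot_eq, finrank_bot, add_zero] at this

theorem dimMod_anti {T T' : Submodule k E} (P : Submodule k E) [FiniteDimensional k P]
    (h : T ≤ T') : dimMod T' P ≤ dimMod T P := by
  have h1 := dimMod_add_finrank_inf T P
  have h2 := dimMod_add_finrank_inf T' P
  have h3 : Module.finrank k (P ⊓ T : Submodule k E) ≤ Module.finrank k (P ⊓ T' : Submodule k E) :=
    Submodule.finrank_mono (inf_le_inf_left P h)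
  omega

theorem dimMod_eq_zero {T P : Submodule k E} (h : P ≤ T) : dimMod T P = 0 := by
  rw [dimMod, LinearMap.le_ker_iff_map.1 (by rwa [Submodule.ker_mkQ]), finrank_bot]

theorem le_of_dimMod_eq_zero {T P : Submodule k E} [FiniteDimensional k P] (h : dimMod T P = 0) :
    P ≤ T := by
  rw [dimMod, Submodule.finrank_eq_zero, ← LinearMap.le_ker_iff_map, Submodule.ker_mkQ] at h
  exact h

theorem dimMod_sup_add {S P : Submodule k E} (T : Submodule k E) [FiniteDimensional k P]
    (h : S ≤ P) : dimMod (T ⊔ S) P + dimMod T S = dimMod T P := by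
  have : FiniteDimensional k S := Submodule.finiteDimensional_of_le h
  have h1 := dimMod_add_finrank_inf T P
  have h2 := dimMod_add_finrank_inf (T ⊔ S) P
  have h3 := dimMod_add_finrank_inf T S
  have h4 := Submodule.finrank_sup_add_finrank_inf_eq (P ⊓ T) S
  have h5 : P ⊓ T ⊔ S = P ⊓ (T ⊔ S) := (inf_sup_assoc_of_le T h).symm ▸ rfl
  have h6 : P ⊓ T ⊓ S = S ⊓ T := by
    rw [inf_comm, ← inf_assoc, inf_eq_left.2 h]
  rw [h5, h6] at h4
  omega

/-- No containment between `T` and the image is required, so `colonForm` can be a preimage in the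
whole ring. -/
theorem dimMod_map (f : E →ₗ[k] F) (P : Submodule k E) (T : Submodule k F) :
    dimMod T (P.map f) = dimMod (T.comap f) P := by
  have hinj : Function.Injective ((T.comap f).mapQ T f le_rfl) := by
    rw [← LinearMap.ker_eq_bot, Submodule.ker_mapQ, Submodule.mkQ_map_self]
  rw [dimMod, dimMod, LinearEquiv.finrank_eq (Submodule.equivMapOfInjective _ hinj _), ← Submodule.map_comp,
    ← Submodule.map_comp, Submodule.mapQ_mkQ]

end Codim

/-! ### Generic parameters and semicontinuity of rank. -/

section Generic

variable {k ι : Type*} [Field k]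

/-- `p` holds on a nonempty Zariski open set of parameters. -/
def IsGeneric (p : (ι → k) → Prop) : Prop :=
  ∃ P : MvPolynomial ι k, P ≠ 0 ∧ ∀ a, MvPolynomial.eval a P ≠ 0 → p a

theorem IsGeneric.and {p q : (ι → k) → Prop} (hp : IsGeneric p) (hq : IsGeneric q) :
    IsGeneric fun a => p a ∧ q a := by
  obtain ⟨P, hP, hp⟩ := hp
  obtain ⟨Q, hQ, hq⟩ := hq
  refine ⟨P * Q, mul_ne_zero hP hQ, fun a ha => ?_⟩
  rw [map_mul] at ha
  exact ⟨hp a (left_ne_zero_of_mul ha), hq a (right_ne_zero_of_mul ha)⟩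

theorem IsGeneric.exists [Infinite k] {p : (ι → k) → Prop} (hp : IsGeneric p) : ∃ a, p a := by
  obtain ⟨P, hP, hp⟩ := hp
  by_contra! hcon
  refine hP (MvPolynomial.funext fun a => ?_)
  rw [map_zero]
  by_contra h
  exact hcon a (hp a h)

theorem IsGeneric.mono {p q : (ι → k) → Prop} (hp : IsGeneric p) (h : ∀ a, p a → q a) :
    IsGeneric q := by
  obtain ⟨P, hP, hp⟩ := hp
  exact ⟨P, hP, fun a ha => h a (hp a ha)⟩

variable {E F : Type*} [AddCommGroup E] [Module k E] [AddCommGroup F] [Module k F]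

/-- The rank of a linear family of linear maps is lower semicontinuous. -/
theorem isGeneric_finrank_range_le [Fintype ι] [FiniteDimensional k E] (f : ι → E →ₗ[k] F)
    (b : ι → k) :
    IsGeneric fun a : ι → k => Module.finrank k (LinearMap.range (∑ t, b t • f t)) ≤
      Module.finrank k (LinearMap.range (∑ t, a t • f t)) := by
  classical
  set g := ∑ t, b t • f t with hg
  let w := Module.finBasis k (LinearMap.range g)
  have hv : ∀ i, ∃ v, g v = w i := fun i => (w i).2
  choose v hv using hv
  let W : (Fin (Module.finrank k (LinearMap.range g)) → k) →ₗ[k] F :=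
    (LinearMap.range g).subtype ∘ₗ w.equivFun.symm.toLinearMap
  obtain ⟨p, hp⟩ := W.exists_leftInverse_of_injective
    (LinearMap.ker_eq_bot.2 ((Submodule.injective_subtype _).comp w.equivFun.symm.injective))
  have hpw : ∀ i, p (w i) = Pi.single i 1 := fun i => by
    have := LinearMap.congr_fun hp (Pi.single i 1)
    simpa [W, Module.Basis.equivFun_symm_apply, Pi.single_apply] using this
  -- The map with parameter `a`, restricted to the `v j` and projected by `p`, as a matrix with
  -- entries linear in `a`. It is the identity at `a = b`, so its determinant is a nonzero
  -- polynomial.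
  let M : Matrix (Fin (Module.finrank k (LinearMap.range g)))
      (Fin (Module.finrank k (LinearMap.range g))) (MvPolynomial ι k) :=
    Matrix.of fun i j => ∑ t, MvPolynomial.C (p (f t (v j)) i) * MvPolynomial.X t
  have hM : ∀ a, (MvPolynomial.eval a).mapMatrix M =
      Matrix.of fun i j => p ((∑ t, a t • f t) (v j)) i := fun a => by
    ext i j
    simp [M, LinearMap.sum_apply, Finset.sum_apply, mul_comm]
  refine ⟨M.det, fun h0 => ?_, fun a ha => ?_⟩
  · have h1 : MvPolynomial.eval b M.det = 1 := by
      rw [RingHom.map_det, hM, ← hg]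
      rw [show (Matrix.of fun i j => p (g (v j)) i) = 1 by
        ext i j
        simp [hv, hpw, Matrix.one_apply, Pi.single_apply], Matrix.det_one]
    rw [h0, map_zero] at h1
    exact zero_ne_one h1
  · rw [RingHom.map_det, hM] at ha
    set ga := ∑ t, a t • f t with hga
    have hu := (Matrix.isUnit_iff_isUnit_det _).2 (isUnit_iff_ne_zero.2 ha)
    have hli : LinearIndependent k fun j => (fun i => p (ga (v j)) i) :=
      Matrix.linearIndependent_cols_iff_isUnit.2 hu
    have hli2 : LinearIndependent k fun j => ga (v j) := LinearIndependent.of_comp p hli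
    have hli3 : LinearIndependent k
        fun j => (⟨ga (v j), v j, rfl⟩ : LinearMap.range ga) :=
      LinearIndependent.of_comp (LinearMap.range ga).subtype hli2
    simpa using hli3.fintype_card_le_finrank

end Generic

/-! ### Green's and Macaulay's theorems for graded quotients. -/

section Green

variable {k B : Type*} [Field k] [CommRing B] [Algebra k B] {ι : Type*} [Fintype ι]

/-- The linear form with coefficients `a`. -/
def linForm (x : ι → B) (a : ι → k) : B := ∑ t, a t • x t

/-- The degree `n` forms in the `x t`. -/
def formsOfDegree (k : Type*) [Field k] [Algebra k B] (x : ι → B) (n : ℕ) : Submodule k B :=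
  Submodule.span k (Set.range x) ^ n

instance (x : ι → B) (n : ℕ) : FiniteDimensional k (formsOfDegree k x n) :=
  Module.Finite.iff_fg.2 ((Submodule.fg_span (Set.finite_range x)).pow n)

theorem linForm_mem_span (x : ι → B) (a : ι → k) :
    linForm x a ∈ Submodule.span k (Set.range x) :=
  Submodule.sum_mem _ fun t _ => Submodule.smul_mem _ _ (Submodule.subset_span ⟨t, rfl⟩)

theorem exists_linForm_eq {x : ι → B} {v : B} (hv : v ∈ Submodule.span k (Set.range x)) :
    ∃ a : ι → k, linForm x a = v :=
  (Submodule.mem_span_range_iff_exists_fun k).1 hv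

theorem map_mulLeft_formsOfDegree_le (x : ι → B) (a : ι → k) (n : ℕ) :
    (formsOfDegree k x n).map (LinearMap.mulLeft k (linForm x a)) ≤ formsOfDegree k x (n + 1) := by
  rintro _ ⟨y, hy, rfl⟩
  rw [LinearMap.mulLeft_apply, formsOfDegree, pow_succ']
  exact Submodule.mul_mem_mul (linForm_mem_span x a) hy

theorem formsOfDegree_succ_le {x : ι → B} {n : ℕ} {T : Submodule k B}
    (h : ∀ a : ι → k, (formsOfDegree k x n).map (LinearMap.mulLeft k (linForm x a)) ≤ T) :
    formsOfDegree k x (n + 1) ≤ T := by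
  rw [formsOfDegree, pow_succ', Submodule.mul_le]
  intro v hv y hy
  obtain ⟨a, rfl⟩ := exists_linForm_eq hv
  exact h a ⟨y, hy, rfl⟩

/-- The graded pieces of a homogeneous ideal of the algebra generated by the `x t`: a sequence of
subspaces which is stable under multiplication by linear forms. -/
def IsGradedIdeal (x : ι → B) (J : ℕ → Submodule k B) : Prop :=
  ∀ (a : ι → k) (n : ℕ), ∀ f ∈ J n, linForm x a * f ∈ J (n + 1)

/-- The Hilbert function of the quotient by the graded ideal `J`. -/
noncomputable def quotHilb (x : ι → B) (J : ℕ → Submodule k B) (n : ℕ) : ℕ :=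
  dimMod (J n) (formsOfDegree k x n)

/-- The graded pieces of the ideal `J + (z)`, for the linear form `z` with coefficients `a`. -/
def addForm (x : ι → B) (J : ℕ → Submodule k B) (a : ι → k) : ℕ → Submodule k B
  | 0 => J 0
  | n + 1 => J (n + 1) ⊔ (formsOfDegree k x n).map (LinearMap.mulLeft k (linForm x a))

/-- The graded pieces of the ideal `J : z`, for the linear form `z` with coefficients `a`. -/
def colonForm (x : ι → B) (J : ℕ → Submodule k B) (a : ι → k) (n : ℕ) : Submodule k B :=
  (J (n + 1)).comap (LinearMap.mulLeft k (linForm x a))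

variable {x : ι → B} {J : ℕ → Submodule k B}

theorem IsGradedIdeal.addForm (hJ : IsGradedIdeal x J) (a : ι → k) :
    IsGradedIdeal x (addForm x J a) := by
  intro b n f hf
  cases n with
  | zero => exact Submodule.mem_sup_left (hJ b 0 f hf)
  | succ n =>
    obtain ⟨g, hg, _, ⟨y, hy, rfl⟩, rfl⟩ := Submodule.mem_sup.1 hf
    rw [mul_add]
    refine add_mem (Submodule.mem_sup_left (hJ b _ g hg)) (Submodule.mem_sup_right ?_)
    refine ⟨linForm x b * y, map_mulLeft_formsOfDegree_le x b n ⟨y, hy, rfl⟩, ?_⟩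
    simp only [LinearMap.mulLeft_apply]
    ring

theorem IsGradedIdeal.colonForm (hJ : IsGradedIdeal x J) (a : ι → k) :
    IsGradedIdeal x (colonForm x J a) := by
  intro b n f hf
  have := hJ b _ _ hf
  simp only [LinearMap.mulLeft_apply] at this
  rwa [mul_left_comm] at this

/-- The exact sequence `0 → (B/(J : z))(-1) → B/J → B/(J + (z)) → 0`, read in degree `n + 1`. -/
theorem quotHilb_addForm_add_colonForm (x : ι → B) (J : ℕ → Submodule k B) (a : ι → k) (n : ℕ) :
    quotHilb x (addForm x J a) (n + 1) + quotHilb x (colonForm x J a) n =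
      quotHilb x J (n + 1) := by
  have h := dimMod_sup_add (J (n + 1)) (map_mulLeft_formsOfDegree_le x a n)
  rwa [dimMod_map] at h

theorem quotHilb_addForm_le (x : ι → B) (J : ℕ → Submodule k B) (a : ι → k) (n : ℕ) :
    quotHilb x (addForm x J a) n ≤ quotHilb x J n := by
  cases n with
  | zero => exact le_rfl
  | succ n => exact dimMod_anti _ le_sup_left

theorem quotHilb_colonForm_le (hJ : IsGradedIdeal x J) (a : ι → k) (n : ℕ) :
    quotHilb x (colonForm x J a) n ≤ quotHilb x J n :=
  dimMod_anti _ fun f hf => hJ a n f hf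

/-- Restricting to a second linear form. -/
theorem quotHilb_addForm_succ_le (x : ι → B) (J : ℕ → Submodule k B) (a b : ι → k) (n : ℕ) :
    quotHilb x (addForm x J b) (n + 1) ≤
      quotHilb x (addForm x (addForm x J a) b) (n + 1) +
        quotHilb x (addForm x (colonForm x J a) b) n := by
  -- With `z`, `w` the forms of `a`, `b`: cut `J + (w)` by `z` and use `(J : z) + (w) ⊆ (J + (w)) :
  -- z`.
  rw [← quotHilb_addForm_add_colonForm x (addForm x J b) a n]
  refine add_le_add (le_of_eq ?_) (dimMod_anti _ ?_)
  · simp only [quotHilb, addForm, sup_right_comm]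
  · cases n with
    | zero => exact Submodule.comap_mono le_sup_left
    | succ n =>
      refine sup_le (Submodule.comap_mono le_sup_left) ?_
      rintro _ ⟨y, hy, rfl⟩
      refine Submodule.mem_sup_right
        ⟨linForm x a * y, map_mulLeft_formsOfDegree_le x a n ⟨y, hy, rfl⟩, ?_⟩
      simp only [LinearMap.mulLeft_apply]
      ring

theorem isGeneric_quotHilb_addForm_le (x : ι → B) (J : ℕ → Submodule k B) (b : ι → k) (n : ℕ) :
    IsGeneric fun a => quotHilb x (addForm x J a) n ≤ quotHilb x (addForm x J b) n := by
  cases n with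
  | zero => exact ⟨1, one_ne_zero, fun _ _ => le_rfl⟩
  | succ n =>
    let f : ι → formsOfDegree k x n →ₗ[k] B ⧸ J (n + 1) := fun t =>
      (J (n + 1)).mkQ ∘ₗ LinearMap.mulLeft k (x t) ∘ₗ (formsOfDegree k x n).subtype
    have hf : ∀ a : ι → k, dimMod (J (n + 1))
        ((formsOfDegree k x n).map (LinearMap.mulLeft k (linForm x a))) =
        Module.finrank k (LinearMap.range (∑ t, a t • f t)) := fun a => by
      have : ∑ t, a t • f t = (J (n + 1)).mkQ ∘ₗ LinearMap.mulLeft k (linForm x a) ∘ₗ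
          (formsOfDegree k x n).subtype := by
        ext y
        simp [f, LinearMap.sum_apply, linForm, Finset.sum_mul, -Submodule.mkQ_apply]
      rw [this, LinearMap.range_comp, LinearMap.range_comp, Submodule.range_subtype]
      rfl
    refine (isGeneric_finrank_range_le f b).mono fun a ha => ?_
    rw [← hf, ← hf] at ha
    have h1 := dimMod_sup_add (J (n + 1)) (map_mulLeft_formsOfDegree_le x a n)
    have h2 := dimMod_sup_add (J (n + 1)) (map_mulLeft_formsOfDegree_le x b n)
    simp only [quotHilb, addForm]
    omega

/-- Green's hyperplane restriction theorem. -/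
theorem exists_quotHilb_addForm_le_greenFun [Infinite k] (hJ : IsGradedIdeal x J) (n : ℕ) :
    ∃ a : ι → k, quotHilb x (addForm x J a) n ≤ greenFun n (quotHilb x J n) := by
  induction n generalizing J with
  | zero => exact ⟨0, le_rfl⟩
  | succ n ihn =>
    induction hH : quotHilb x J (n + 1) using Nat.strong_induction_on generalizing J with
    | _ H ihH =>
    subst hH
    obtain ⟨a, ha⟩ := exists_minimalFor_of_wellFoundedLT (fun _ : ι → k => True)
      (fun a => quotHilb x (addForm x J a) (n + 1)) ⟨0, trivial⟩
    have hmin : ∀ b, quotHilb x (addForm x J a) (n + 1) ≤ quotHilb x (addForm x J b) (n + 1) :=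
      fun b => (le_total _ _).elim id (ha.2 trivial)
    refine ⟨a, ?_⟩
    have hsum := quotHilb_addForm_add_colonForm x J a n
    rcases (quotHilb_addForm_le x J a (n + 1)).lt_or_eq with hlt | heq
    -- Induction on the degree serves `J : z`, induction on the dimension serves `J + (z)`. By
    -- semicontinuity one form `b` achieves both bounds, and minimality of `a` compares `b` with
    -- `a`.
    · obtain ⟨b₁, hb₁⟩ := ihn (hJ.colonForm a)
      obtain ⟨b₂, hb₂⟩ := ihH _ hlt (hJ.addForm a) rfl
      obtain ⟨b, h₁, h₂⟩ := ((isGeneric_quotHilb_addForm_le x (colonForm x J a) b₁ n).and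
        (isGeneric_quotHilb_addForm_le x (addForm x J a) b₂ (n + 1))).exists
      have h₃ := quotHilb_addForm_succ_le x J a b n
      have h₄ := hmin b
      rw [← hsum, add_comm (quotHilb x (addForm x J a) (n + 1))]
      refine le_greenFun_of_le _ _ _ ?_
      omega
    -- If even the best form does not lower the dimension, every product of a linear form with a
    -- form of degree `n` lies in `J`, so the quotient vanishes in degree `n + 1`.
    · have hle : formsOfDegree k x (n + 1) ≤ J (n + 1) := by
        refine formsOfDegree_succ_le fun b => ?_
        have h₁ := hmin b
        have h₂ := quotHilb_addForm_le x J b (n + 1)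
        have h₃ := dimMod_sup_add (J (n + 1)) (map_mulLeft_formsOfDegree_le x b n)
        refine le_of_dimMod_eq_zero ?_
        simp only [quotHilb, addForm] at *
        omega
      rw [heq, quotHilb, dimMod_eq_zero hle]
      exact Nat.zero_le _

/-- Macaulay's bound on the growth of Hilbert functions, read downwards. -/
theorem macaulayFun_quotHilb_le [Infinite k] (hJ : IsGradedIdeal x J) (n : ℕ) :
    macaulayFun (n + 1) (quotHilb x J (n + 1)) ≤ quotHilb x J n := by
  -- What Green's bound leaves over is at most the value of `J : z` in degree `n`, hence at most
  -- that of `J`.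
  obtain ⟨a, ha⟩ := exists_quotHilb_addForm_le_greenFun hJ (n + 1)
  have h1 := quotHilb_addForm_add_colonForm x J a n
  have h2 := quotHilb_colonForm_le hJ a n
  have h3 := macaulayFun_add_greenFun (n + 1) (quotHilb x J (n + 1))
  omega

end Green

end GorensteinBound

/-! ### Gorenstein duality and the bound for the `h`-vector. -/

noncomputable section

namespace GorensteinBound

open MvPolynomial

attribute [local instance] MvPolynomial.gradedAlgebra

/-- The rank of a bilinear form does not depend on the side from which it is read. -/
theorem finrank_range_flip {k E F : Type*} [Field k] [AddCommGroup E] [Module k E]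
    [AddCommGroup F] [Module k F] [FiniteDimensional k E] (f : E →ₗ[k] F →ₗ[k] k) :
    Module.finrank k (LinearMap.range f.flip) = Module.finrank k (LinearMap.range f) := by
  rw [← LinearMap.finrank_range_dualMap_eq_finrank_range f.flip]
  have h : f = f.flip.dualMap ∘ₗ (Module.evalEquiv k E).toLinearMap := by
    ext x y
    simp
  conv_rhs => rw [h]
  rw [LinearMap.range_comp_of_range_eq_top _ (LinearEquiv.range _)]

/-- The classes of the variables. -/
def varClass {k : Type*} [Field k] {r : ℕ} (I : Ideal (MvPolynomial (Fin r) k)) (t : Fin r) :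
    MvPolynomial (Fin r) k ⧸ I := Ideal.Quotient.mk I (X t)

variable {k : Type*} [Field k] {r : ℕ} {I : Ideal (MvPolynomial (Fin r) k)}

theorem formsOfDegree_varClass (I : Ideal (MvPolynomial (Fin r) k)) (d : ℕ) :
    formsOfDegree k (varClass I) d = gradedPiece I d := by
  rw [gradedPiece, ← homogeneousSubmodule_one_pow, Submodule.map_pow,
    homogeneousSubmodule_one_eq_span_X, Submodule.map_span, ← Set.range_comp]
  rfl

instance (d : ℕ) : FiniteDimensional k (gradedPiece I d) :=
  formsOfDegree_varClass I d ▸ inferInstance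

theorem mul_mem_gradedPiece {a b : MvPolynomial (Fin r) k ⧸ I} {m n : ℕ}
    (ha : a ∈ gradedPiece I m) (hb : b ∈ gradedPiece I n) : a * b ∈ gradedPiece I (m + n) := by
  obtain ⟨f, hf, rfl⟩ := ha
  obtain ⟨g, hg, rfl⟩ := hb
  exact ⟨f * g, IsHomogeneous.mul hf hg, map_mul (Ideal.Quotient.mkₐ k I) f g⟩

theorem one_mem_gradedPiece_zero (I : Ideal (MvPolynomial (Fin r) k)) : 1 ∈ gradedPiece I 0 :=
  ⟨1, isHomogeneous_one _ _, map_one (Ideal.Quotient.mkₐ k I)⟩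

theorem varClass_mem_gradedPiece (t : Fin r) : varClass I t ∈ gradedPiece I 1 :=
  ⟨X t, isHomogeneous_X k t, rfl⟩

theorem linForm_mem_gradedPiece (a : Fin r → k) :
    linForm (varClass I) a ∈ gradedPiece I 1 := by
  rw [← formsOfDegree_varClass, formsOfDegree, pow_one]
  exact linForm_mem_span _ a

theorem eq_zero_of_mem_gradedPiece_of_ne (hI : I.IsHomogeneous (homogeneousSubmodule (Fin r) k))
    {a : MvPolynomial (Fin r) k ⧸ I} {m n : ℕ} (hmn : m ≠ n)
    (hm : a ∈ gradedPiece I m) (hn : a ∈ gradedPiece I n) : a = 0 := by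
  obtain ⟨f, hf, rfl⟩ := hm
  obtain ⟨g, hg, hfg⟩ := hn
  have h1 : f - g ∈ I := Ideal.Quotient.eq.1 hfg.symm
  have h2 := homogeneousComponent_mem_of_mem hI h1 m
  rw [map_sub, homogeneousComponent_of_mem hf, homogeneousComponent_of_mem hg, if_pos rfl,
    if_neg hmn, sub_zero] at h2
  exact Ideal.Quotient.eq_zero_iff_mem.2 h2

section Duality

variable {e : ℕ} {h : ℕ → ℕ}

/-- `A_e` is nonzero and killed by the variables, since `A_{e+1} = 0`; the socle is only
one-dimensional. -/
theorem socle_eq_gradedPiece (hI : IsArtinianGorenstein I) (hh : IsHVector I e h) :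
    socle I = gradedPiece I e := by
  have hfin : FiniteDimensional k (socle I) :=
    Module.finite_of_finrank_pos (by rw [hI.finrank_socle]; exact one_pos)
  have h0 : gradedPiece I (e + 1) = ⊥ := by
    rw [← Submodule.finrank_eq_zero (R := k)]
    have := hh.eq_hilbertFunction (e + 1)
    rw [hh.eq_zero_of_gt _ (Nat.lt_succ_self e)] at this
    exact this.symm
  have hle : gradedPiece I e ≤ socle I := fun a ha t => by
    have := mul_mem_gradedPiece (varClass_mem_gradedPiece t) ha
    rw [add_comm, h0] at this
    exact (Submodule.mem_bot k).1 this
  refine (Submodule.eq_of_le_of_finrank_le hle ?_).symm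
  rw [hI.finrank_socle]
  have := hh.last_ne_zero
  rw [hh.eq_hilbertFunction] at this
  exact Nat.one_le_iff_ne_zero.2 this

/-- By induction each `x_t a` vanishes, so `a` is in the socle `A_e`; for `m ≠ e` this forces `a =
0`. -/
theorem eq_zero_of_mul_gradedPiece_eq_zero (hI : IsArtinianGorenstein I) (hh : IsHVector I e h)
    {n : ℕ} {m : ℕ} (hmn : m + n = e) {a : MvPolynomial (Fin r) k ⧸ I}
    (ha : a ∈ gradedPiece I m) (h0 : ∀ b ∈ gradedPiece I n, a * b = 0) : a = 0 := by
  induction n generalizing m a with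
  | zero => simpa using h0 1 (one_mem_gradedPiece_zero I)
  | succ n ih =>
    have hs : a ∈ socle I := fun t => by
      refine ih (m := 1 + m) (by omega)
        (mul_mem_gradedPiece (varClass_mem_gradedPiece t) ha) fun b hb => ?_
      have := h0 _ (add_comm 1 n ▸ mul_mem_gradedPiece (varClass_mem_gradedPiece t) hb)
      rw [mul_comm (Ideal.Quotient.mk I (X t)), mul_assoc]
      exact this
    rw [socle_eq_gradedPiece hI hh] at hs
    exact eq_zero_of_mem_gradedPiece_of_ne hI.homogeneous (by omega) ha hs

/-- A functional on `A` which is injective on the socle. -/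
theorem exists_dual_socle (hI : IsArtinianGorenstein I) (hh : IsHVector I e h) :
    ∃ φ : (MvPolynomial (Fin r) k ⧸ I) →ₗ[k] k, ∀ a ∈ gradedPiece I e, φ a = 0 → a = 0 := by
  have h1 := hI.finrank_socle
  rw [socle_eq_gradedPiece hI hh] at h1
  let E : gradedPiece I e ≃ₗ[k] k := LinearEquiv.ofFinrankEq _ _ (by rw [h1, Module.finrank_self])
  obtain ⟨φ, hφ⟩ := LinearMap.exists_extend E.toLinearMap
  refine ⟨φ, fun a ha h0 => ?_⟩
  have h2 : φ a = E ⟨a, ha⟩ := LinearMap.congr_fun hφ ⟨a, ha⟩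
  rw [h0] at h2
  exact congrArg Subtype.val (E.map_eq_zero_iff.1 h2.symm)

/-- Multiplication by a form is self-dual on an artinian Gorenstein algebra. -/
theorem finrank_map_mulLeft_gradedPiece (hI : IsArtinianGorenstein I) (hh : IsHVector I e h)
    {z : MvPolynomial (Fin r) k ⧸ I} {d m n : ℕ} (hz : z ∈ gradedPiece I d) (he : d + m + n = e) :
    Module.finrank k ((gradedPiece I m).map (LinearMap.mulLeft k z)) =
      Module.finrank k ((gradedPiece I n).map (LinearMap.mulLeft k z)) := by
  obtain ⟨φ, hφ⟩ := exists_dual_socle hI hh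
  -- The form `(u, v) ↦ φ(zuv)`: nondegeneracy makes its left kernel that of `z` on `A_m`, and
  -- commutativity makes its transpose `f n m`.
  let f (m n : ℕ) : gradedPiece I m →ₗ[k] gradedPiece I n →ₗ[k] k :=
    (((LinearMap.mul k (MvPolynomial (Fin r) k ⧸ I)).compr₂ φ).compl₂
      (gradedPiece I n).subtype) ∘ₗ LinearMap.mulLeft k z ∘ₗ (gradedPiece I m).subtype
  have hf : ∀ m n (u : gradedPiece I m) (v : gradedPiece I n), f m n u v = φ (z * u * v) :=
    fun m n u v => rfl
  have key : ∀ m n, d + m + n = e → Module.finrank k (LinearMap.range (f m n)) =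
      Module.finrank k ((gradedPiece I m).map (LinearMap.mulLeft k z)) := by
    intro m n he
    have h1 := LinearMap.finrank_range_add_finrank_ker (f m n)
    have h2 := LinearMap.finrank_range_add_finrank_ker
      ((LinearMap.mulLeft k z).domRestrict (gradedPiece I m))
    rw [LinearMap.range_domRestrict] at h2
    have h3 : LinearMap.ker (f m n) =
        LinearMap.ker ((LinearMap.mulLeft k z).domRestrict (gradedPiece I m)) := by
      ext u
      rw [LinearMap.mem_ker, LinearMap.mem_ker, LinearMap.domRestrict_apply,
        LinearMap.mulLeft_apply]
      constructor
      · intro hu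
        refine eq_zero_of_mul_gradedPiece_eq_zero hI hh he (mul_mem_gradedPiece hz u.2)
          fun b hb => ?_
        refine hφ _ (he ▸ mul_mem_gradedPiece (mul_mem_gradedPiece hz u.2) hb) ?_
        rw [← hf m n u ⟨b, hb⟩, hu, LinearMap.zero_apply]
      · intro hu
        ext v
        rw [hf, hu, zero_mul, map_zero, LinearMap.zero_apply]
    rw [h3] at h1
    omega
  rw [← key m n he, ← key n m (by omega), ← finrank_range_flip (f m n)]
  have hflip : (f m n).flip = f n m := by
    ext u v
    rw [LinearMap.flip_apply, hf, hf, mul_right_comm]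
  rw [hflip]

theorem hilbertFunction_symm (hI : IsArtinianGorenstein I) (hh : IsHVector I e h) {m n : ℕ}
    (he : m + n = e) : h m = h n := by
  have := finrank_map_mulLeft_gradedPiece hI hh (one_mem_gradedPiece_zero I) (m := m) (n := n)
    (by omega)
  rw [LinearMap.mulLeft_one, Submodule.map_id, Submodule.map_id] at this
  rw [hh.eq_hilbertFunction, hh.eq_hilbertFunction]
  exact this

end Duality

theorem isGradedIdeal_bot : IsGradedIdeal (k := k) (varClass I) fun _ => ⊥ := by
  intro a n f hf
  rw [Submodule.mem_bot] at hf ⊢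
  rw [hf, mul_zero]

theorem quotHilb_bot (I : Ideal (MvPolynomial (Fin r) k)) (n : ℕ) :
    quotHilb (k := k) (varClass I) (fun _ => ⊥) n = hilbertFunction I n := by
  rw [quotHilb, dimMod_bot, formsOfDegree_varClass, hilbertFunction]

theorem quotHilb_addForm_bot (a : Fin r → k) (n : ℕ) :
    quotHilb (varClass I) (addForm (varClass I) (fun _ => ⊥) a) (n + 1) +
      Module.finrank k ((gradedPiece I n).map (LinearMap.mulLeft k (linForm (varClass I) a))) =
      hilbertFunction I (n + 1) := by
  have h1 := dimMod_sup_add ⊥ (map_mulLeft_formsOfDegree_le (varClass I) a n)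
  rw [dimMod_bot, dimMod_bot] at h1
  rw [hilbertFunction, ← formsOfDegree_varClass I n, ← formsOfDegree_varClass I (n + 1)]
  exact h1

/-- The bound in terms of Green's and Macaulay's functions. -/
theorem hVector_bound [Infinite k] {e : ℕ} {h : ℕ → ℕ} (hI : IsArtinianGorenstein I)
    (hh : IsHVector I e h) {i s : ℕ} (he : e = i + (i + 1 + s)) :
    macaulayFun (i + 1 + s) (h i) +
        macaulayIter (i + 1) s (greenFun (i + 1 + s) (h i)) ≤ h (i + 1) := by
  obtain ⟨a, ha⟩ := exists_quotHilb_addForm_le_greenFun (isGradedIdeal_bot (I := I)) (i + 1 + s)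
  set c := quotHilb (varClass I) (addForm (varClass I) (fun _ => ⊥) a) with hc
  rw [quotHilb_bot, ← hh.eq_hilbertFunction,
    ← hilbertFunction_symm hI hh (m := i) (by omega)] at ha
  have h1 := quotHilb_addForm_bot (I := I) a i
  have h2 := quotHilb_addForm_bot (I := I) a (i + s)
  have h3 := finrank_map_mulLeft_gradedPiece hI hh (linForm_mem_gradedPiece a) (m := i)
    (n := i + s) (by omega)
  rw [show i + s + 1 = i + 1 + s by omega, ← h3, ← hh.eq_hilbertFunction,
    ← hilbertFunction_symm hI hh (m := i) (by omega)] at h2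
  rw [← hh.eq_hilbertFunction] at h1
  rw [← hc] at h1 h2
  have h4 := macaulayIter_le (d := i + 1) s
    (macaulayFun_quotHilb_le ((isGradedIdeal_bot (I := I)).addForm a))
  rw [← hc] at h4
  -- `c` in degree `i + 1 + s` enters with both signs; monotonicity of the difference lets its upper
  -- bound replace it.
  have h5 := macaulayIter_sub_mono (i + 1) s ha
  have h6 := macaulayFun_add_greenFun (i + 1 + s) (h i)
  omega

end GorensteinBound

end

/-! ### Evaluation on binomial expansions. -/

namespace GorensteinBound

theorem add_le_add_of_forall_lt_succ {i j : ℕ} {N : ℕ → ℕ} (hlt : ∀ t, j ≤ t → t < i → N t < N (t + 1))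
    {u : ℕ} (hu : j ≤ u) {t : ℕ} (h1 : u ≤ t) (h2 : t ≤ i) :
    N u + t ≤ N t + u := by
  induction t, h1 using Nat.le_induction with
  | base => exact le_rfl
  | succ t h ih =>
    have := ih (by omega)
    have := hlt t (by omega) (by omega)
    omega

theorem sum_choose_lt {d j : ℕ} {N : ℕ → ℕ} (hj : 1 ≤ j) (hjd : j ≤ d) (hN : j ≤ N j)
    (hlt : ∀ t, j ≤ t → t < d → N t < N (t + 1)) :
    ∑ t ∈ Finset.Icc j d, (N t).choose t < (N d + 1).choose d := by
  induction d, hjd using Nat.le_induction with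
  | base =>
    obtain ⟨l, rfl⟩ : ∃ l, j = l + 1 := ⟨j - 1, by omega⟩
    have : 0 < (N (l + 1)).choose l := Nat.choose_pos (by omega)
    rw [Finset.Icc_self, Finset.sum_singleton, Nat.choose_succ_succ']
    omega
  | succ d hd ih =>
    have h1 := ih fun t h1 h2 => hlt t h1 (by omega)
    have h2 : (N d + 1).choose d ≤ (N (d + 1)).choose d :=
      Nat.choose_le_choose d (hlt d hd (by omega))
    rw [Finset.sum_Icc_succ_top (by omega), Nat.choose_succ_succ']
    omega

theorem macaulayFun_sum_choose {d j : ℕ} {N : ℕ → ℕ} (hj : 1 ≤ j) (hjd : j ≤ d) (hN : j ≤ N j)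
    (hlt : ∀ t, j ≤ t → t < d → N t < N (t + 1)) :
    macaulayFun d (∑ t ∈ Finset.Icc j d, (N t).choose t) =
      ∑ t ∈ Finset.Icc j d, (N t - 1).choose (t - 1) := by
  induction d, hjd using Nat.le_induction with
  | base =>
    obtain ⟨l, rfl⟩ : ∃ l, j = l + 1 := ⟨j - 1, by omega⟩
    have := macaulayFun_succ (d := l) (p := N (l + 1)) (ρ := 0) (by omega)
      (Nat.choose_pos (by omega))
    rw [macaulayFun_zero_right] at this
    simpa using this
  | succ d hd ih =>
    have h1 := ih fun t h1 h2 => hlt t h1 (by omega)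
    have h2 : (N d + 1).choose d ≤ (N (d + 1)).choose d :=
      Nat.choose_le_choose d (hlt d hd (by omega))
    have h3 := sum_choose_lt hj hd hN fun t h1 h2 => hlt t h1 (by omega)
    rw [Finset.sum_Icc_succ_top (by omega), Finset.sum_Icc_succ_top (by omega),
      add_comm (∑ t ∈ Finset.Icc j d, (N t).choose t),
      macaulayFun_succ (by have := hlt d hd (by omega); omega) (h3.trans_le h2), h1, add_comm, Nat.add_sub_cancel]

theorem sum_Icc_pred {M : Type*} [AddCommMonoid M] {j d : ℕ} (hj : 1 ≤ j) (f : ℕ → M) :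
    ∑ t ∈ Finset.Icc (j - 1) d, f (t + 1) = ∑ t ∈ Finset.Icc j (d + 1), f t := by
  refine Finset.sum_nbij' (· + 1) (· - 1) ?_ ?_ ?_ ?_ ?_ <;> intro t ht <;>
    simp only [Finset.mem_Icc] at * <;> omega

/-- Each step lowers both entries of every binomial by one, leaving a valid expansion. The condition
`s ≤ j` keeps the lower entries positive until the last step. -/
theorem macaulayIter_sum_choose {d j s : ℕ} {N : ℕ → ℕ} (hsj : s ≤ j) (hjd : j ≤ d + s)
    (hN : j ≤ N j) (hlt : ∀ t, j ≤ t → t < d + s → N t < N (t + 1)) :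
    macaulayIter d s (∑ t ∈ Finset.Icc j (d + s), (N t).choose t) =
      ∑ t ∈ Finset.Icc j (d + s), (N t - s).choose (t - s) := by
  induction s generalizing j N with
  | zero => rfl
  | succ s ih =>
    have hj : 1 ≤ j := by omega
    have h1 := ih (j := j - 1) (N := fun t => N (t + 1) - 1) (by omega) (by omega)
      (by rw [Nat.sub_add_cancel hj]; omega) fun t h1 h2 => by
        have h3 := hlt (t + 1) (by omega) (by omega)
        have h4 := add_le_add_of_forall_lt_succ hlt le_rfl (t := t + 1) (by omega) (by omega)
        omega
    have h2 := macaulayFun_sum_choose hj hjd hN hlt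
    rw [macaulayIter, show d + s + 1 = d + (s + 1) by omega, h2, ← show d + s + 1 = d + (s + 1) by
      omega, ← sum_Icc_pred hj, ← sum_Icc_pred hj]
    simp only [Nat.add_sub_cancel]
    rw [h1]
    refine Finset.sum_congr rfl fun t _ => ?_
    rw [Nat.sub_sub, Nat.add_comm 1 s, Nat.add_sub_add_right]

variable {n d j : ℕ} {N : ℕ → ℕ}

theorem IsBinomialExpansion.le_apply (hN : IsBinomialExpansion n d j N) {t : ℕ} (h1 : j ≤ t)
    (h2 : t ≤ d) : t ≤ N t := by
  have := add_le_add_of_forall_lt_succ hN.lt_succ le_rfl h1 h2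
  have := hN.le_last
  omega

theorem IsBinomialExpansion.macaulayFun_eq (hN : IsBinomialExpansion n d j N) :
    macaulayFun d n = ∑ t ∈ Finset.Icc j d, (N t - 1).choose (t - 1) := by
  rw [hN.sum_eq, macaulayFun_sum_choose hN.one_le hN.le_top hN.le_last hN.lt_succ]

theorem IsBinomialExpansion.greenFun_eq (hN : IsBinomialExpansion n d j N) :
    greenFun d n = ∑ t ∈ Finset.Icc j d, (N t - 1).choose t := by
  have h1 := macaulayFun_add_greenFun d n
  have h2 : ∑ t ∈ Finset.Icc j d, (N t - 1).choose (t - 1) +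
      ∑ t ∈ Finset.Icc j d, (N t - 1).choose t = n := by
    rw [hN.sum_eq, ← Finset.sum_add_distrib]
    refine Finset.sum_congr rfl fun t ht => ?_
    rw [Finset.mem_Icc] at ht
    have h3 := hN.le_apply ht.1 ht.2
    have h4 := hN.one_le
    obtain ⟨l, rfl⟩ : ∃ l, t = l + 1 := ⟨t - 1, by omega⟩
    rw [choose_pred_add (p := N (l + 1)) l (by omega), Nat.add_sub_cancel, add_comm]
  rw [hN.macaulayFun_eq] at h1
  omega

theorem binom_eq_choose {m q : ℤ} {a b : ℕ} (hm : m = a) (hq : q = b) :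
    binom m q = a.choose b := by
  subst hm hq
  unfold binom
  split_ifs with h
  · rw [Nat.choose_eq_zero_of_lt (by omega)]
  · simp

theorem binom_eq_zero {m q : ℤ} (h : m < q ∨ q < 0) : binom m q = 0 := if_pos h

theorem IsBinomialExpansion.shiftedSum_neg_one (hN : IsBinomialExpansion n d j N) :
    shiftedSum d j N (-1) (-1) = macaulayFun d n := by
  rw [hN.macaulayFun_eq]
  refine Finset.sum_congr rfl fun t ht => ?_
  rw [Finset.mem_Icc] at ht
  have h1 := hN.le_apply ht.1 ht.2
  have h2 := hN.one_le
  exact binom_eq_choose (by omega) (by omega)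

theorem IsBinomialExpansion.shiftedSum_le {s : ℕ} (hN : IsBinomialExpansion n (d + s) j N) :
    shiftedSum (d + s) j N (-(s : ℤ)) (-((s : ℤ) + 1)) ≤
      macaulayIter d s (greenFun (d + s) n) := by
  classical
  rw [hN.greenFun_eq]
  -- The terms `(N t - 1).choose t` with `N t = t` vanish, and those with `t < s` cannot be shifted
  -- `s` times. Since `N t - t` is nondecreasing, the other terms form a tail starting at the least
  -- such `u`, which is a genuine expansion. Dropping the rest can only lower `macaulayIter`, while
  -- the corresponding terms of `shiftedSum` are zero.
  by_cases hex : ∃ u, j ≤ u ∧ u ≤ d + s ∧ s ≤ u ∧ u < N u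
  · obtain ⟨h1, h2, h3, h4⟩ := Nat.find_spec hex
    have hmin : ∀ t, t < Nat.find hex → _ := fun t ht => Nat.find_min hex ht
    set u := Nat.find hex
    have hsub : Finset.Icc u (d + s) ⊆ Finset.Icc j (d + s) := Finset.Icc_subset_Icc_left h1
    have hge : ∀ t, u ≤ t → t ≤ d + s → t < N t := fun t ht1 ht2 => by
      have := add_le_add_of_forall_lt_succ hN.lt_succ h1 ht1 ht2
      omega
    refine le_trans (le_of_eq ?_) (macaulayIter_mono d s (Finset.sum_le_sum_of_subset hsub))
    rw [macaulayIter_sum_choose h3 h2 (by omega) fun t ht1 ht2 => by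
        have := hge t ht1 ht2.le
        have := hN.lt_succ t (by omega) ht2
        omega]
    rw [shiftedSum, ← Finset.sum_subset hsub]
    · refine Finset.sum_congr rfl fun t ht => ?_
      rw [Finset.mem_Icc] at ht
      have := hge t ht.1 ht.2
      exact binom_eq_choose (by omega) (by omega)
    · intro t ht1 ht2
      rw [Finset.mem_Icc] at ht1 ht2
      have := hmin t (by omega)
      exact binom_eq_zero (by omega)
  · rw [shiftedSum, Finset.sum_eq_zero]
    · exact Nat.zero_le _
    · intro t ht
      rw [Finset.mem_Icc] at ht
      have := not_exists.1 hex t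
      exact binom_eq_zero (by omega)

end GorensteinBound

theorem theorem2p3 {k : Type*} [Field k] [Infinite k] (r e : ℕ)
    (I : Ideal (MvPolynomial (Fin r) k)) (hI : GorensteinBound.IsArtinianGorenstein I)
    (h : ℕ → ℕ) (hh : GorensteinBound.IsHVector I e h) (h_one : h 1 = r)
    (i : ℕ) (hi : 1 ≤ i) (hie : (i : ℚ) ≤ (e : ℚ) / 2 - 1)
    (j : ℕ) (N : ℕ → ℕ) (hN : GorensteinBound.IsBinomialExpansion (h i) (e - i) j N) :
    h (i + 1) ≥
      GorensteinBound.shiftedSum (e - i) j N (-1) (-1) +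
      GorensteinBound.shiftedSum (e - i) j N
        (-((e : ℤ) - 2 * (i : ℤ) - 1)) (-((e : ℤ) - 2 * (i : ℤ))) := by
  have hle : 2 * i + 2 ≤ e := by
    have : (2 * i + 2 : ℚ) ≤ e := by linarith
    exact_mod_cast this
  -- `s` counts the Macaulay steps from degree `e - i` down to `i + 1`.
  obtain ⟨s, he⟩ : ∃ s, e = i + (i + 1 + s) := ⟨e - 2 * i - 1, by omega⟩
  rw [show e - i = i + 1 + s by omega] at hN ⊢
  rw [show (e : ℤ) - 2 * i - 1 = s by omega, show (e : ℤ) - 2 * i = s + 1 by omega,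
    hN.shiftedSum_neg_one]
  exact (Nat.add_le_add_left hN.shiftedSum_le _).trans (GorensteinBound.hVector_bound hI hh he)
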